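/- Let $K$ be a field, and let $\Phi : \mathbb{P}^2\times\mathbb{P}^2\times\mathbb{P}^2 \dashrightarrow \mathrm{Gr}(3,6)\subset\mathbb{P}^{19}$ be the rational map whose coordinates are the twenty $3\times 3$ minors, regarded as polynomials in $K[x_0,x_1,x_2,y_0,y_1,y_2,z_0,z_1,z_2]$, of the matrix $$\begin{pmatrix} x_0^2 & x_1^2 & x_2^2 & x_0 x_1 & x_0 x_2 & x_1 x_2 \\ y_0^2 & y_1^2 & y_2^2 & y_0 y_1 & y_0 y_2 & y_1 y_2 \\ z_0^2 & z_1^2 & z_2^2 & z_0 z_1 & z_0 z_2 & z_1 z_2 \end{pmatrix}.$$ Let $\mathrm{NP}(\Phi)\subset\mathbb{R}^9$ be the Newton polytope of $\Phi$, that is, the Minkowski sum of the Newton polytopes of these twenty minors, where the Newton polytope of a polynomial is the convex hull of the exponent vectors of the monomials occurring in it with nonzero coefficient. Then $\mathrm{NP}(\Phi)$ is $4$-dimensional and has f-vector $(504, 1056, 684, 132)$: it has exactly $504$ vertices, $1056$ edges, $684$ two-dimensional faces and $132$ facets. -/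

import Mathlib

open scoped Pointwise

noncomputable section

/-- The Newton polytope of a polynomial: the convex hull in `ℝ^σ` of the exponent vectors of the
monomials that occur in it with a nonzero coefficient. -/
def newtonPolytope {σ K : Type*} [CommSemiring K] (p : MvPolynomial σ K) : Set (σ → ℝ) :=
  convexHull ℝ ((fun (m : σ →₀ ℕ) (i : σ) => (m i : ℝ)) '' (p.support : Set (σ →₀ ℕ)))

/-- The Newton polytope of the (rational) map with coordinate polynomials `f i`: the Minkowski sum
of the Newton polytopes of its coordinates. -/
def newtonPolytopeOfMap {ι σ K : Type*} [Fintype ι] [CommSemiring K]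
    (f : ι → MvPolynomial σ K) : Set (σ → ℝ) :=
  ∑ i, newtonPolytope (f i)

/-- The dimension of a subset of a real vector space: the dimension of its affine hull. -/
def polytopeDim {V : Type*} [AddCommGroup V] [Module ℝ V] (P : Set V) : ℕ :=
  Module.finrank ℝ (vectorSpan ℝ P)

/-- The `k`-dimensional faces of a polytope `P`. A nonempty face is the set of all points of `P`
at which some linear functional attains its maximum over `P`. -/
def polytopeFaces {V : Type*} [AddCommGroup V] [Module ℝ V] [TopologicalSpace V]
    (P : Set V) (k : ℕ) : Set (Set V) :=
  {F | F.Nonempty ∧ IsExposed ℝ P F ∧ polytopeDim F = k}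

/-- `HasFVector P v`, for `v : Fin d → ℕ`: the polytope `P` has dimension `d`, and for each `k < d`
it has finitely many `k`-dimensional faces, `v k` in number. -/
def HasFVector {V : Type*} [AddCommGroup V] [Module ℝ V] [TopologicalSpace V]
    {d : ℕ} (P : Set V) (v : Fin d → ℕ) : Prop :=
  polytopeDim P = d ∧ ∀ k : Fin d, (polytopeFaces P k).encard = v k

/-- The `3 × 6` matrix of all quadratic monomials in three points of the projective plane. The
variable `(i, j)` is the `j`-th homogeneous coordinate of the `i`-th point, so that the points are
`x = (X (0, ·))`, `y = (X (1, ·))`, `z = (X (2, ·))`. -/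
def quadricMatrix (K : Type*) [CommRing K] :
    Matrix (Fin 3) (Fin 6) (MvPolynomial (Fin 3 × Fin 3) K) :=
  Matrix.of fun i =>
    let u : Fin 3 → MvPolynomial (Fin 3 × Fin 3) K := fun j => MvPolynomial.X (i, j)
    ![u 0 ^ 2, u 1 ^ 2, u 2 ^ 2, u 0 * u 1, u 0 * u 2, u 1 * u 2]

/-- The three-point map `Φ : ℙ² × ℙ² × ℙ² ⇢ Gr(3,6) ⊂ ℙ¹⁹`, given by its twenty coordinate
polynomials: for each set `S` of three columns, the `3 × 3` minor of `quadricMatrix K` on the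
columns in `S`, taken in increasing order. -/
def threePointMap (K : Type*) [CommRing K] (S : {S : Finset (Fin 6) // S.card = 3}) :
    MvPolynomial (Fin 3 × Fin 3) K :=
  ((quadricMatrix K).submatrix id (S.1.orderEmbOfFin S.2)).det

end

/-! Over any field the six terms of a minor are distinct monomials with coefficients ±1. Nothing
cancels, so the polytope is a Minkowski sum of twenty hulls of six points each and does not depend
on `K`. A weight on the nine variables cuts out a face, and this face is determined by which of the
120 monomials are maximal within their minors. These bits form the mask of the weight: equal faces
have equal masks, and inclusion of faces is inclusion of bits (`weightFace_subset_iff`).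

The weights `t i + u j` are constant on the monomials of each minor. Hence the dimension is at most
4 (`polytopeDim_minorPolytope_le`), and the normal fan lives in a four-dimensional quotient. Sixteen
orthants cover this quotient; each is subdivided into simplicial cones so small that in every minor
some monomial is maximal for all four generators. On such a cone the mask of a weight is the bitwise
AND of the masks of the generators with nonzero coefficient (`realMask_combination`), so finitely
many masks account for all faces (`realMask_eq_fullMask_or_mem`).

Dimensions come from chains: a face strictly inside another has smaller dimension, so four strictly
nested proper faces of a polytope of dimension at most 4 have dimensions 0, 1, 2, 3, and the
polytope has dimension 4 (`polytopeDim_of_isStrictFlag`). The computation `fanCheck_fanCones`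
verifies the common maxima, finds every mask of the fan in such a chain, and counts the masks at the
four levels. The subdivision is only a certificate, since any tree of splittings covers its cone
(`Subdivision.exists_mem_cones`). -/

noncomputable section

/-! ### Faces of a Minkowski sum -/

/-- The points of `P` at which `l` attains its maximum over `P`. -/
def maximalFace {V : Type*} (P : Set V) (l : V → ℝ) : Set V :=
  {x ∈ P | ∀ y ∈ P, l y ≤ l x}

theorem maximalFace_subset {V : Type*} (P : Set V) (l : V → ℝ) : maximalFace P l ⊆ P :=
  fun _ hx => hx.1

theorem vectorSpan_maximalFace_le {V : Type*} [AddCommGroup V] [Module ℝ V] (P : Set V)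
    (l : V →ₗ[ℝ] ℝ) : vectorSpan ℝ (maximalFace P l) ≤ LinearMap.ker l := by
  rw [vectorSpan_def, Submodule.span_le]
  rintro _ ⟨a, ha, b, hb, rfl⟩
  simp [le_antisymm (hb.2 a ha.1) (ha.2 b hb.1)]

/-- The `k`-th point of the `i`-th family maximizes `l` on that family. -/
def IsMaximizer {V ι κ : Type*} (p : ι → κ → V) (l : V → ℝ) (i : ι) (k : κ) : Prop :=
  ∀ k', l (p i k') ≤ l (p i k)

theorem exists_isMaximizer {V ι κ : Type*} [Finite κ] [Nonempty κ] (p : ι → κ → V) (l : V → ℝ)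
    (i : ι) : ∃ k, IsMaximizer p l i k := Finite.exists_max fun k => l (p i k)

section MinkowskiSum

variable {V ι κ : Type*} [AddCommGroup V] [Module ℝ V] [Fintype ι]

/-- The Minkowski sum of the convex hulls of the families `p i`. -/
def hullSum (p : ι → κ → V) : Set V := ∑ i, convexHull ℝ (Set.range (p i))

theorem mem_hullSum {p : ι → κ → V} {x : V} :
    x ∈ hullSum p ↔ ∃ g : ι → V, (∀ i, g i ∈ convexHull ℝ (Set.range (p i))) ∧ ∑ i, g i = x := by
  simp [hullSum, Set.mem_fintype_sum]

theorem sum_mem_hullSum (p : ι → κ → V) (k : ι → κ) : ∑ i, p i (k i) ∈ hullSum p :=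
  mem_hullSum.2 ⟨fun i => p i (k i), fun i => subset_convexHull ℝ _ ⟨k i, rfl⟩, rfl⟩

theorem le_of_mem_convexHull_range {q : κ → V} {l : V →ₗ[ℝ] ℝ} {c : ℝ}
    (h : ∀ k, l (q k) ≤ c) {x : V} (hx : x ∈ convexHull ℝ (Set.range q)) : l x ≤ c := by
  have : convexHull ℝ (Set.range q) ⊆ {x | l x ≤ c} :=
    convexHull_min (by rintro _ ⟨k, rfl⟩; exact h k) (convex_halfSpace_le l.isLinear c)
  exact this hx

theorem sum_mem_maximalFace {p : ι → κ → V} {l : V →ₗ[ℝ] ℝ} {k : ι → κ}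
    (hk : ∀ i, IsMaximizer p l i (k i)) : ∑ i, p i (k i) ∈ maximalFace (hullSum p) l := by
  refine ⟨sum_mem_hullSum p k, fun y hy => ?_⟩
  obtain ⟨g, hg, rfl⟩ := mem_hullSum.1 hy
  simp only [map_sum]
  exact Finset.sum_le_sum fun i _ => le_of_mem_convexHull_range (hk i) (hg i)

theorem maximalFace_hullSum_nonempty [Finite κ] [Nonempty κ] (p : ι → κ → V) (l : V →ₗ[ℝ] ℝ) :
    (maximalFace (hullSum p) l).Nonempty := by
  choose k hk using exists_isMaximizer p l
  exact ⟨_, sum_mem_maximalFace hk⟩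

/-- A sum of maximizers of `l` also maximizes `l'`, so exchanging its `i`-th summand alone cannot
increase `l'`. -/
theorem isMaximizer_of_maximalFace_subset [Finite κ] [Nonempty κ] {p : ι → κ → V}
    {l l' : V →ₗ[ℝ] ℝ}
    (h : maximalFace (hullSum p) l ⊆ maximalFace (hullSum p) l') {i : ι} {k : κ}
    (hk : IsMaximizer p l i k) : IsMaximizer p l' i k := by
  classical
  intro k'
  choose m hm using exists_isMaximizer p l
  have hx := h (sum_mem_maximalFace (k := Function.update m i k) fun j => by
    rcases eq_or_ne j i with rfl | hj
    · simpa using hk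
    · simpa [hj] using hm j)
  have := hx.2 _ (sum_mem_hullSum p (Function.update m i k'))
  rw [map_sum, map_sum, ← Finset.add_sum_erase _ _ (Finset.mem_univ i),
    ← Finset.add_sum_erase _ (fun j => l' (p j (Function.update m i k j))) (Finset.mem_univ i),
    Finset.sum_congr rfl (g := fun j => l' (p j (Function.update m i k j)))] at this
  · simp only [Function.update_self] at this
    linarith
  · intro j hj
    simp [Finset.ne_of_mem_erase hj]

/-- For large `M`, the form `M • l - l'` is maximal at the sum of the chosen maximizers `m i` of
`l`. A point where `l` is maximal has the same value of `l` as this sum, hence at least its value of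
`l'`, which is the maximum. -/
theorem maximalFace_subset_of_isMaximizer [Finite κ] [Nonempty κ] {p : ι → κ → V}
    {l l' : V →ₗ[ℝ] ℝ}
    (h : ∀ i k, IsMaximizer p l i k → IsMaximizer p l' i k) :
    maximalFace (hullSum p) l ⊆ maximalFace (hullSum p) l' := by
  classical
  have := Fintype.ofFinite κ
  choose m hm using exists_isMaximizer p l
  have hm' : ∀ i, IsMaximizer p l' i (m i) := fun i => h i _ (hm i)
  -- `N` bounds the ratio of the two gaps. Where the `l`-gap vanishes, the hypothesis makes the
  -- `l'`-gap vanish too, and `N = 0` serves.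
  have key : ∀ i k, ∃ N : ℝ, 0 ≤ N ∧
      l' (p i (m i)) - l' (p i k) ≤ N * (l (p i (m i)) - l (p i k)) := by
    intro i k
    rcases (hm i k).lt_or_eq with hlt | heq
    · have hpos := sub_pos.2 hlt
      refine ⟨_ / _, div_nonneg (sub_nonneg.2 (hm' i k)) hpos.le, ?_⟩
      rw [div_mul_cancel₀ _ hpos.ne']
    · refine ⟨0, le_rfl, ?_⟩
      have : IsMaximizer p l' i k := h i k fun k' => heq ▸ hm i k'
      linarith [this (m i)]
  choose N hN0 hN using key
  let M := ∑ i, ∑ k, N i k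
  have hM : ∀ i k, N i k ≤ M := fun i k =>
    (Finset.single_le_sum (fun k _ => hN0 i k) (Finset.mem_univ k)).trans
      (Finset.single_le_sum (f := fun i => ∑ k, N i k)
        (fun i _ => Finset.sum_nonneg fun k _ => hN0 i k) (Finset.mem_univ i))
  have hle : ∀ i k, (M • l - l') (p i k) ≤ (M • l - l') (p i (m i)) := by
    intro i k
    have h1 := hN i k
    have h2 := mul_le_mul_of_nonneg_right (hM i k) (sub_nonneg.2 (hm i k))
    simp only [LinearMap.sub_apply, LinearMap.smul_apply, smul_eq_mul]
    linarith
  rintro x ⟨hxP, hx⟩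
  refine ⟨hxP, fun y hy => (((sum_mem_maximalFace hm').2 y hy).trans ?_)⟩
  have h3 := hx _ (sum_mem_hullSum p m)
  have h4 := (sum_mem_maximalFace hm).2 x hxP
  have h5 : (M • l - l') x ≤ (M • l - l') (∑ i, p i (m i)) := by
    obtain ⟨g, hg, rfl⟩ := mem_hullSum.1 hxP
    rw [map_sum, map_sum]
    exact Finset.sum_le_sum fun i _ => le_of_mem_convexHull_range (hle i) (hg i)
  simp only [LinearMap.sub_apply, LinearMap.smul_apply, smul_eq_mul, le_antisymm h4 h3] at h5
  linarith

/-- Every point of every family maximizes `l`, so the maximal face of `l` contains that of the zero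
form, which is everything. -/
theorem vectorSpan_hullSum_le_ker [Finite κ] [Nonempty κ] {p : ι → κ → V} {l : V →ₗ[ℝ] ℝ}
    (h : ∀ i k k', l (p i k) = l (p i k')) : vectorSpan ℝ (hullSum p) ≤ LinearMap.ker l := by
  have h0 : hullSum p ⊆ maximalFace (hullSum p) (0 : V →ₗ[ℝ] ℝ) := fun x hx =>
    ⟨hx, fun _ _ => le_rfl⟩
  exact (vectorSpan_mono ℝ (h0.trans (maximalFace_subset_of_isMaximizer
    fun i k _ k' => (h i k' k).le))).trans (vectorSpan_maximalFace_le _ l)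

end MinkowskiSum

/-! ### Dimensions of faces -/

/-- If the two directions coincided, they would lie in the kernel of `l`, and `l` would be maximal
on all of `G`. -/
theorem polytopeDim_maximalFace_lt {V : Type*} [AddCommGroup V] [Module ℝ V] [FiniteDimensional ℝ V]
    {P G : Set V} {l : V →ₗ[ℝ] ℝ} (hne : (maximalFace P l).Nonempty) (hGP : G ⊆ P)
    (h : maximalFace P l ⊂ G) : polytopeDim (maximalFace P l) < polytopeDim G := by
  obtain ⟨x, hxG, hx⟩ := Set.exists_of_ssubset h
  obtain ⟨f, hf⟩ := hne
  refine Submodule.finrank_lt_finrank_of_lt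
    (lt_of_le_of_ne (vectorSpan_mono ℝ h.subset) fun heq => hx ?_)
  have hmem : x -ᵥ f ∈ vectorSpan ℝ (maximalFace P l) :=
    heq ▸ vsub_mem_vectorSpan ℝ hxG (h.subset hf)
  have hxf : l x = l f := by
    simpa [sub_eq_zero] using vectorSpan_maximalFace_le P l hmem
  exact ⟨hGP hxG, fun y hy => hxf ▸ hf.2 y hy⟩

/-- On a finite-dimensional space, the faces of a set are given by arbitrary linear forms. -/
theorem mem_polytopeFaces_iff {V : Type*} [AddCommGroup V] [Module ℝ V] [TopologicalSpace V]
    [IsTopologicalAddGroup V] [ContinuousSMul ℝ V] [T2Space V] [FiniteDimensional ℝ V]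
    {P F : Set V} {k : ℕ} :
    F ∈ polytopeFaces P k ↔
      ∃ l : V →ₗ[ℝ] ℝ, F = maximalFace P l ∧ F.Nonempty ∧ polytopeDim F = k := by
  constructor
  · rintro ⟨hne, hexp, hdim⟩
    obtain ⟨l, hl⟩ := hexp hne
    exact ⟨l.toLinearMap, hl, hne, hdim⟩
  · rintro ⟨l, hl, hne, hdim⟩
    exact ⟨hne, fun _ => ⟨LinearMap.toContinuousLinearMap l, hl⟩, hdim⟩

/-! ### Integral weights and their masks -/

/-- The exponents of the six quadratic monomials in three variables. -/
def quadricExponent : Fin 6 → Fin 3 → ℕ :=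
  ![![2, 0, 0], ![0, 2, 0], ![0, 0, 2], ![1, 1, 0], ![1, 0, 1], ![0, 1, 1]]

/-- A nonnegative integral weight on the nine variables. -/
abbrev IntWeight := Fin 3 → Fin 3 → ℕ

/-- The weights of the six quadratic monomials, given the weights of the three variables. -/
def quadricWeight (r : Fin 3 → ℕ) : Fin 6 → ℕ :=
  ![2 * r 0, 2 * r 1, 2 * r 2, r 0 + r 1, r 0 + r 2, r 1 + r 2]

/-- The twenty sets of three columns. -/
def columnTriples : List (Fin 6 × Fin 6 × Fin 6) :=
  [(0, 1, 2), (0, 1, 3), (0, 1, 4), (0, 1, 5), (0, 2, 3), (0, 2, 4), (0, 2, 5), (0, 3, 4),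
   (0, 3, 5), (0, 4, 5), (1, 2, 3), (1, 2, 4), (1, 2, 5), (1, 3, 4), (1, 3, 5), (1, 4, 5),
   (2, 3, 4), (2, 3, 5), (2, 4, 5), (3, 4, 5)]

/-- The larger of two natural numbers. -/
def natMax (a b : ℕ) : ℕ := cond (Nat.ble a b) b a

/-- Prepends to `m` the six bits that say which of six numbers are the largest. -/
def prependMaxBits (a b c d e f m : ℕ) : ℕ :=
  let t := natMax a (natMax b (natMax c (natMax d (natMax e f))))
  Nat.bit (Nat.beq a t) (Nat.bit (Nat.beq b t) (Nat.bit (Nat.beq c t)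
    (Nat.bit (Nat.beq d t) (Nat.bit (Nat.beq e t) (Nat.bit (Nat.beq f t) m)))))

/-- The mask of an integral weight: 120 bits, six for each of the twenty minors, that tell which of
the six monomials of the minor have maximal weight. -/
def mask (g : IntWeight) : ℕ :=
  columnTriples.foldr (fun (i, j, k) m =>
    prependMaxBits
      (quadricWeight (g 0) i + quadricWeight (g 1) j + quadricWeight (g 2) k)
      (quadricWeight (g 0) i + quadricWeight (g 1) k + quadricWeight (g 2) j)
      (quadricWeight (g 0) j + quadricWeight (g 1) i + quadricWeight (g 2) k)
      (quadricWeight (g 0) j + quadricWeight (g 1) k + quadricWeight (g 2) i)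
      (quadricWeight (g 0) k + quadricWeight (g 1) i + quadricWeight (g 2) j)
      (quadricWeight (g 0) k + quadricWeight (g 1) j + quadricWeight (g 2) i) m) 0

/-- The mask with all 120 bits set. -/
def fullMask : ℕ := 1329227995784915872903807060280344575

/-- Whether each of the first `n` groups of six bits contains a set bit. -/
def hitsBlocks : ℕ → ℕ → Bool
  | 0, _ => true
  | n + 1, m => cond (Nat.beq (m % 64) 0) false (hitsBlocks n (m / 64))

/-! ### Subdivisions of simplicial cones -/

/-- The generators of a four-dimensional simplicial cone. -/
inductive Cone where
  | mk (x y z t : IntWeight)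

/-- A binary tree of splittings of a simplicial cone. At a node labelled `d`, the pair of generators
number `d / 3` is replaced by a positive combination, chosen by `d % 3`. -/
inductive Subdivision where
  | leaf
  | node (d : ℕ) (l r : Subdivision)

/-- Moves the pair of generators number `p` to the front. -/
def Cone.moveToFront : ℕ → Cone → Cone
  | 0, .mk x y z t => .mk x y z t
  | 1, .mk x y z t => .mk x z y t
  | 2, .mk x y z t => .mk x t y z
  | 3, .mk x y z t => .mk y z x t
  | 4, .mk x y z t => .mk y t x z
  | _, .mk x y z t => .mk z t x y

/-- A positive combination of two weights. -/
def combination : ℕ → IntWeight → IntWeight → IntWeight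
  | 0, x, y => fun i j => x i j + y i j
  | 1, x, y => fun i j => 2 * x i j + y i j
  | _, x, y => fun i j => x i j + 2 * y i j

/-- The cones at the leaves of a subdivision, in front of `acc`. -/
def Subdivision.cones : Subdivision → Cone → List Cone → List Cone
  | .leaf, C, acc => C :: acc
  | .node d l r, C, acc =>
    match C.moveToFront (d / 3) with
    | .mk x y z t =>
      let w := combination (d % 3) x y
      l.cones (.mk w y z t) (r.cones (.mk x w z t) acc)

/-- Reads a subdivision from the base 19 digits of a number, in preorder, `0` being a leaf. -/
def Subdivision.decode {α : Type} : ℕ → ℕ → (Subdivision → ℕ → α) → α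
  | 0, n, k => k .leaf n
  | fuel + 1, n, k =>
    match n % 19 with
    | 0 => k .leaf (n / 19)
    | d + 1 => decode fuel (n / 19) fun l n₁ => decode fuel n₁ fun r n₂ => k (.node d l r) n₂

/-- Codes of subdivisions of the sixteen orthants on whose leaves the type of a weight is determined
by the masks of the generators. -/
def subdivisionCodes : List ℕ :=
  [1697034851142808938069636904052463309425448728387704475424035084798104625879187727844193301234488926485320277095735029629432750884884210937599729490860118547696328757455861695268864,
   16295282201706744948213490988702633752886082026407288505412379151647609091618982115180359963023302072556896906370001904988429286284759797391452990866769747995,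
   13239921762132953233655472404965062054634966670018129582662841133545462004687909472230364139479338503403629715803367366150946606272624723288577281024946558301,
   50046159268875334550409826351420293806765623571278786863694634060088,
   16295282201706744948213490988702633752886082026407288505412379151647609091618982115180359963023302072556896906370001904988429286284759797391452990866769748010,
   50046231273012668967818773795704331677815926636637666118486490148904,
   2085441,
   2304264293878282169101436613982320262663796606,
   13239921762132953233655472404965062054634966670018129582662841133545462004687909472230364139479338503403629715803367366150946606272624723288577281024946558316,
   2085441,
   50046231273012668967818773795704331677815926636637666118486490148913,
   43520776033806513674739882177643502301930684189,
   50046159268875334550409826351420293806765623571278786863694634060103,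
   2304264293878282169101436613982320262663796591,
   43520776033806513674739882177643502301930684174,
   398322631456366459603970031086781658894271114867433243904888865177978383530515253661538858258447275179276516281117242542932271163150581028602285849353804885316570290800132493947285887271816680653603142062037453407522091721229561662616651568809458507684414944773787791799798850053221225690338759242975730206856777949584451297642277991115527736479255609065399541317042945429684]

/-- The weights that generate, together with their negatives modulo the lineality space, the space
of all weights. -/
def coordinateWeight (i j : Fin 3) : IntWeight :=
  fun a b => if a = i ∧ b = j then 1 else 0

/-- A nonnegative weight equivalent to the negative of `coordinateWeight i j`. -/
def oppositeWeight (i j : Fin 3) : IntWeight :=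
  fun a b => if b = j ∧ a ≠ i then 1 else 0

/-- The sixteen orthants. -/
def orthants : List Cone :=
  [coordinateWeight 1 1, oppositeWeight 1 1].flatMap fun x =>
    [coordinateWeight 1 2, oppositeWeight 1 2].flatMap fun y =>
      [coordinateWeight 2 1, oppositeWeight 2 1].flatMap fun z =>
        [coordinateWeight 2 2, oppositeWeight 2 2].map fun t => .mk x y z t

/-- The cones of the subdivided fan. -/
def fanCones : List Cone :=
  (orthants.zip subdivisionCodes).foldr
    (fun p acc => (Subdivision.decode 12 p.2 fun s _ => s).cones p.1 acc) []

/-! ### Flags of masks -/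

/-- The masks of the generators of a cone. -/
def Cone.masks : Cone → ℕ × ℕ × ℕ × ℕ
  | .mk x y z t => (mask x, mask y, mask z, mask t)

/-- The flag of masks `a, a ∧ b, a ∧ b ∧ c, a ∧ b ∧ c ∧ d`, if it is strictly decreasing. -/
def strictFlag (a b c d : ℕ) (acc : List (ℕ × ℕ × ℕ × ℕ)) : List (ℕ × ℕ × ℕ × ℕ) :=
  let a₂ := Nat.land a b
  let a₃ := Nat.land a₂ c
  let a₄ := Nat.land a₃ d
  cond (Nat.beq a fullMask) acc (cond (Nat.beq a₂ a) acc (cond (Nat.beq a₃ a₂) acc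
    (cond (Nat.beq a₄ a₃) acc ((a₄, a₃, a₂, a) :: acc))))

/-- Strict flags of masks for four of the orderings of the generators of each cone. -/
def strictFlags (L : List (ℕ × ℕ × ℕ × ℕ)) : List (ℕ × ℕ × ℕ × ℕ) :=
  L.foldr (fun q acc => strictFlag q.2.1 q.1 q.2.2.2 q.2.2.1
    (strictFlag q.2.2.1 q.1 q.2.1 q.2.2.2 (strictFlag q.2.2.1 q.2.2.2 q.2.1 q.1
      (strictFlag q.2.2.2 q.1 q.2.2.1 q.2.1 acc)))) []

/-- A binary search tree of natural numbers. -/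
inductive SearchTree where
  | nil
  | node (l : SearchTree) (k : ℕ) (r : SearchTree)

namespace SearchTree

/-- Inserts a number and passes on the resulting tree. -/
def insert {α : Type} (n : ℕ) (T : SearchTree) : (SearchTree → α) → α :=
  SearchTree.rec (motive := fun _ => (SearchTree → α) → α) (fun f => f (node nil n nil))
    (fun l k r insertLeft insertRight f => cond (Nat.beq n k) (f (node l k r))
      (cond (Nat.ble n k) (insertLeft fun l' => f (node l' k r))
        (insertRight fun r' => f (node l k r')))) T

/-- Inserts the numbers of a list and passes on the resulting tree. -/
def insertAll {α : Type} : List ℕ → SearchTree → (SearchTree → α) → α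
  | [], T, f => f T
  | n :: L, T, f => insert n T fun T' => insertAll L T' f

/-- Searches for a number. -/
def find (n : ℕ) (T : SearchTree) : Bool :=
  SearchTree.rec (motive := fun _ => Bool) false
    (fun _ k _ findLeft findRight => cond (Nat.beq n k) true
      (cond (Nat.ble n k) findLeft findRight)) T

/-- The numbers in a tree, in front of `acc`. -/
def toList : SearchTree → List ℕ → List ℕ
  | nil, acc => acc
  | node l k r, acc => l.toList (k :: r.toList acc)

end SearchTree

/-- Whether a list is strictly increasing, starts with a number at least `a`, and has length `n`. -/
def isIncreasing : List ℕ → ℕ → ℕ → Bool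
  | [], _, n => Nat.beq n 0
  | k :: L, a, n =>
    cond (Nat.ble 1 n) (cond (Nat.ble a k) (isIncreasing L (k + 1) (n - 1)) false) false

/-- The masks of the four generators. -/
def generatorMasks (q : ℕ × ℕ × ℕ × ℕ) : List ℕ :=
  let (x, y, z, t) := q
  [x, y, z, t]

/-- The masks of the six pairs of generators. -/
def pairMasks (q : ℕ × ℕ × ℕ × ℕ) : List ℕ :=
  let (x, y, z, t) := q
  [Nat.land x y, Nat.land z t, Nat.land x z, Nat.land x t, Nat.land y z, Nat.land y t]

/-- The masks of the four triples of generators. -/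
def tripleMasks (q : ℕ × ℕ × ℕ × ℕ) : List ℕ :=
  let (x, y, z, t) := q
  [Nat.land (Nat.land x y) z, Nat.land (Nat.land x y) t, Nat.land x (Nat.land z t),
    Nat.land y (Nat.land z t)]

/-- The mask of all four generators. -/
def totalMask (q : ℕ × ℕ × ℕ × ℕ) : ℕ :=
  let (x, y, z, t) := q
  Nat.land (Nat.land x y) (Nat.land z t)

/-- All the finite checks on the subdivided fan. -/
def fanCheck (L : List (ℕ × ℕ × ℕ × ℕ)) (F : List (ℕ × ℕ × ℕ × ℕ)) : Bool :=
  SearchTree.insertAll (F.map (·.1)) .nil fun T₀ =>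
  SearchTree.insertAll (F.map (·.2.1)) .nil fun T₁ =>
  SearchTree.insertAll (F.map (·.2.2.1)) .nil fun T₂ =>
  SearchTree.insertAll (F.map (·.2.2.2)) .nil fun T₃ =>
    isIncreasing (T₀.toList []) 0 504 && isIncreasing (T₁.toList []) 0 1056 &&
    isIncreasing (T₂.toList []) 0 684 && isIncreasing (T₃.toList []) 0 132 &&
    L.all fun q => hitsBlocks 20 (totalMask q) &&
      ((generatorMasks q).all fun m =>
        T₃.find m || (T₂.find m || (T₁.find m || T₀.find m))) &&
      ((pairMasks q).all fun m => T₂.find m || (T₁.find m || T₀.find m)) &&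
      ((tripleMasks q).all fun m => T₁.find m || T₀.find m) && T₀.find (totalMask q)

/-- The one large computation. All that is needed of the subdivision codes is that this check
succeeds. -/
theorem fanCheck_fanCones :
    fanCheck (fanCones.map Cone.masks) (strictFlags (fanCones.map Cone.masks)) = true := by
  decide +kernel

/-! ### The Newton polytopes of the minors -/

theorem quadricExponent_injective : Function.Injective quadricExponent := by decide

/-- The exponents of the product of the entries of `quadricMatrix` in the columns `c`, one for each
row. -/
def productExponent (c : Fin 3 → Fin 6) : (Fin 3 × Fin 3) →₀ ℕ :=
  Finsupp.equivFunOnFinite.symm fun ij => quadricExponent (c ij.1) ij.2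

theorem productExponent_injective : Function.Injective productExponent := by
  intro c c' h
  funext i
  refine quadricExponent_injective (funext fun j => ?_)
  exact DFunLike.congr_fun h (i, j)

theorem quadricMatrix_apply (K : Type*) [CommRing K] (i : Fin 3) (c : Fin 6) :
    quadricMatrix K i c = ∏ j, MvPolynomial.X (i, j) ^ quadricExponent c j := by
  fin_cases c <;> simp [quadricMatrix, quadricExponent, Fin.prod_univ_three]

theorem prod_quadricMatrix (K : Type*) [CommRing K] (c : Fin 3 → Fin 6) :
    ∏ i, quadricMatrix K i (c i) = MvPolynomial.monomial (productExponent c) 1 := by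
  rw [MvPolynomial.monomial_eq, map_one, one_mul,
    Finsupp.prod_fintype _ _ (fun _ => pow_zero _), Fintype.prod_prod_type]
  exact Finset.prod_congr rfl fun i _ => quadricMatrix_apply K i (c i)

/-- The three columns of a minor, in the order given by a permutation. -/
def minorColumns (S : {S : Finset (Fin 6) // S.card = 3}) (σ : Equiv.Perm (Fin 3)) :
    Fin 3 → Fin 6 := S.1.orderEmbOfFin S.2 ∘ σ

theorem minorColumns_injective (S : {S : Finset (Fin 6) // S.card = 3}) :
    Function.Injective (minorColumns S) := by
  intro σ τ h
  ext1 i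
  exact (S.1.orderEmbOfFin S.2).injective (congr_fun h i)

theorem threePointMap_eq (K : Type*) [CommRing K] (S : {S : Finset (Fin 6) // S.card = 3}) :
    threePointMap K S = ∑ σ : Equiv.Perm (Fin 3),
      MvPolynomial.monomial (productExponent (minorColumns S σ)) ((σ.sign : ℤ) : K) := by
  -- The Leibniz formula permutes row indices; transposing makes `σ` act on the columns, as in
  -- `minorColumns`.
  rw [threePointMap, ← Matrix.det_transpose, Matrix.det_apply']
  refine Finset.sum_congr rfl fun σ _ => ?_
  have := prod_quadricMatrix K (minorColumns S σ)
  simp only [Matrix.transpose_apply, Matrix.submatrix_apply, id, minorColumns,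
    Function.comp_apply] at this ⊢
  rw [this, ← map_intCast (MvPolynomial.C : K →+* MvPolynomial (Fin 3 × Fin 3) K),
    MvPolynomial.C_mul_monomial, mul_one]

/-- Distinct permutations give distinct monomials, and the coefficients ±1 are nonzero in every
characteristic. -/
theorem support_threePointMap (K : Type*) [Field K] (S : {S : Finset (Fin 6) // S.card = 3}) :
    ((threePointMap K S).support : Set ((Fin 3 × Fin 3) →₀ ℕ)) =
      Set.range fun σ => productExponent (minorColumns S σ) := by
  classical
  ext m
  simp only [Finset.mem_coe, MvPolynomial.mem_support_iff, threePointMap_eq,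
    MvPolynomial.coeff_sum, MvPolynomial.coeff_monomial, Set.mem_range]
  constructor
  · intro h
    obtain ⟨σ, -, hσ⟩ := Finset.exists_ne_zero_of_sum_ne_zero h
    exact ⟨σ, by by_contra hne; simp [hne] at hσ⟩
  · rintro ⟨σ, rfl⟩
    rw [Finset.sum_eq_single σ]
    · rcases Int.units_eq_one_or σ.sign with h | h <;> simp [h]
    · intro τ _ hτ
      exact if_neg fun h => hτ (minorColumns_injective S (productExponent_injective h))
    · simp

/-- The exponent vector of a product of three entries, as a point of the space of the polytope. -/
def columnPoint (c : Fin 3 → Fin 6) : Fin 3 × Fin 3 → ℝ :=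
  fun ij => (quadricExponent (c ij.1) ij.2 : ℝ)

theorem newtonPolytopeOfMap_threePointMap (K : Type*) [Field K] :
    newtonPolytopeOfMap (threePointMap K) = hullSum fun S σ => columnPoint (minorColumns S σ) := by
  refine Finset.sum_congr rfl fun S _ => ?_
  rw [newtonPolytope, support_threePointMap, ← Set.range_comp]
  rfl

theorem sum_quadricExponent (c : Fin 6) : ∑ j, quadricExponent c j = 2 := by
  revert c; decide

/-- A linear form on the space of the polytope, given by its coefficients. -/
def weightForm (w : Fin 3 → Fin 3 → ℝ) : (Fin 3 × Fin 3 → ℝ) →ₗ[ℝ] ℝ :=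
  ∑ i, ∑ j, w i j • LinearMap.proj (i, j)

theorem weightForm_apply (w : Fin 3 → Fin 3 → ℝ) (x : Fin 3 × Fin 3 → ℝ) :
    weightForm w x = ∑ i, ∑ j, w i j * x (i, j) := by
  simp [weightForm]

theorem exists_eq_weightForm (l : (Fin 3 × Fin 3 → ℝ) →ₗ[ℝ] ℝ) : ∃ w, l = weightForm w := by
  refine ⟨fun i j => l fun k => if (i, j) = k then 1 else 0, LinearMap.ext fun x => ?_⟩
  rw [LinearMap.pi_apply_eq_sum_univ l x, weightForm_apply, Fintype.sum_prod_type]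
  simp only [smul_eq_mul, mul_comm]

/-- Each entry of the matrix has degree 2, so the `t` part is always `2 * ∑ i, t i`; the `u` part
depends only on the multiset of columns. -/
theorem weightForm_lineality (t u : Fin 3 → ℝ) (c : Fin 3 → Fin 6) (π : Equiv.Perm (Fin 3)) :
    weightForm (fun i j => t i + u j) (columnPoint (c ∘ π)) =
      weightForm (fun i j => t i + u j) (columnPoint c) := by
  have h : ∀ c : Fin 3 → Fin 6, weightForm (fun i j => t i + u j) (columnPoint c) =
      2 * ∑ i, t i + ∑ i, ∑ j, u j * quadricExponent (c i) j := by
    intro c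
    have hc : ∀ i, ∑ j, (quadricExponent (c i) j : ℝ) = 2 := fun i => by
      exact_mod_cast sum_quadricExponent (c i)
    simp only [weightForm_apply, columnPoint, add_mul, Finset.sum_add_distrib, ← Finset.mul_sum, hc]
    rw [← Finset.sum_mul, mul_comm]
  rw [h, h]
  congr 1
  exact Equiv.sum_comp π fun i => ∑ j, u j * (quadricExponent (c i) j : ℝ)

/-- The polytope of the three-point map, described by the exponents of its minors. -/
def minorPolytope : Set (Fin 3 × Fin 3 → ℝ) :=
  hullSum fun S σ => columnPoint (minorColumns S σ)

/-- Vectors in the direction of the polytope have zero row and column sums, as 3 × 3 arrays, so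
their lower right 2 × 2 block determines them. -/
theorem polytopeDim_minorPolytope_le : polytopeDim minorPolytope ≤ 4 := by
  have hker : ∀ t u : Fin 3 → ℝ, ∀ x ∈ vectorSpan ℝ minorPolytope,
      ∑ i, ∑ j, (t i + u j) * x (i, j) = 0 := by
    intro t u x hx
    rw [← weightForm_apply]
    refine vectorSpan_hullSum_le_ker (fun S σ τ => ?_) hx
    exact (weightForm_lineality t u _ σ).trans (weightForm_lineality t u _ τ).symm
  let f : (Fin 3 × Fin 3 → ℝ) →ₗ[ℝ] (Fin 4 → ℝ) :=
    LinearMap.pi ![LinearMap.proj (1, 1), LinearMap.proj (1, 2), LinearMap.proj (2, 1),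
      LinearMap.proj (2, 2)]
  have hinj : Function.Injective (f.domRestrict (vectorSpan ℝ minorPolytope)) := by
    rw [← LinearMap.ker_eq_bot, LinearMap.ker_eq_bot']
    rintro ⟨x, hx⟩ h
    have h0 : x (1, 1) = 0 := congr_fun h 0
    have h1 : x (1, 2) = 0 := congr_fun h 1
    have h2 : x (2, 1) = 0 := congr_fun h 2
    have h3 : x (2, 2) = 0 := congr_fun h 3
    have r1 := hker ![0, 1, 0] 0 x hx
    have r2 := hker ![0, 0, 1] 0 x hx
    have c0 := hker 0 ![1, 0, 0] x hx
    have c1 := hker 0 ![0, 1, 0] x hx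
    have c2 := hker 0 ![0, 0, 1] x hx
    simp [Fin.sum_univ_three, h0, h1, h2, h3] at r1 r2 c0 c1 c2
    ext ⟨i, j⟩
    fin_cases i <;> fin_cases j <;> simp_all
  simpa [polytopeDim] using LinearMap.finrank_le_finrank_of_injective hinj

/-! ### Masks of real weights -/

/-- The product of three entries in the columns `c` has maximal weight among its rearrangements. -/
def IsMaximal (w : Fin 3 → Fin 3 → ℝ) (c : Fin 3 → Fin 6) : Prop :=
  ∀ π : Equiv.Perm (Fin 3),
    weightForm w (columnPoint (c ∘ π)) ≤ weightForm w (columnPoint c)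

/-- The orderings of a triple of columns. -/
def orderings (s : Fin 6 × Fin 6 × Fin 6) : List (Fin 3 → Fin 6) :=
  [![s.1, s.2.1, s.2.2], ![s.1, s.2.2, s.2.1], ![s.2.1, s.1, s.2.2], ![s.2.1, s.2.2, s.1],
    ![s.2.2, s.1, s.2.1], ![s.2.2, s.2.1, s.1]]

theorem mem_orderings_iff {s : Fin 6 × Fin 6 × Fin 6} {c : Fin 3 → Fin 6} :
    c ∈ orderings s ↔ ∃ π : Equiv.Perm (Fin 3), c = ![s.1, s.2.1, s.2.2] ∘ π := by
  obtain ⟨i, j, k⟩ := s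
  constructor
  · have key : ∀ π : Fin 3 → Fin 3, Function.Injective π →
        ∃ σ : Equiv.Perm (Fin 3), ![i, j, k] ∘ π = ![i, j, k] ∘ σ := fun π hπ =>
      ⟨Equiv.ofBijective π (Finite.injective_iff_bijective.1 hπ), rfl⟩
    intro h
    simp only [orderings, List.mem_cons, List.not_mem_nil, or_false] at h
    rcases h with rfl | rfl | rfl | rfl | rfl | rfl
    · simpa [← List.ofFn_inj] using key ![0, 1, 2] (by decide)
    · simpa [← List.ofFn_inj] using key ![0, 2, 1] (by decide)
    · simpa [← List.ofFn_inj] using key ![1, 0, 2] (by decide)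
    · simpa [← List.ofFn_inj] using key ![1, 2, 0] (by decide)
    · simpa [← List.ofFn_inj] using key ![2, 0, 1] (by decide)
    · simpa [← List.ofFn_inj] using key ![2, 1, 0] (by decide)
  · rintro ⟨π, rfl⟩
    have key : ∀ π : Equiv.Perm (Fin 3), ⇑π ∈ ([![0, 1, 2], ![0, 2, 1], ![1, 0, 2], ![1, 2, 0],
        ![2, 0, 1], ![2, 1, 0]] : List (Fin 3 → Fin 3)) := by decide
    have := List.mem_map_of_mem (f := fun π : Fin 3 → Fin 3 => ![i, j, k] ∘ π) (key π)
    simpa [orderings, ← List.ofFn_inj] using this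

theorem isMaximal_iff {w : Fin 3 → Fin 3 → ℝ} {s : Fin 6 × Fin 6 × Fin 6} {c : Fin 3 → Fin 6}
    (hc : c ∈ orderings s) :
    IsMaximal w c ↔
      ∀ c' ∈ orderings s, weightForm w (columnPoint c') ≤ weightForm w (columnPoint c) := by
  obtain ⟨σ, rfl⟩ := mem_orderings_iff.1 hc
  constructor
  · intro h c' hc'
    obtain ⟨τ, rfl⟩ := mem_orderings_iff.1 hc'
    have := h (σ⁻¹ * τ)
    rwa [Function.comp_assoc, ← Equiv.Perm.coe_mul, mul_inv_cancel_left] at this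
  · intro h π
    exact h _ (mem_orderings_iff.2 ⟨σ * π, rfl⟩)

/-! ### Bit strings of predicates -/

theorem bit_eq_bit_iff {b b' : Bool} {m n : ℕ} : Nat.bit b m = Nat.bit b' n ↔ b = b' ∧ m = n := by
  cases b <;> cases b' <;> simp [Nat.bit_val] <;> omega

open Classical in
/-- Prepends to `m` the bits that tell which elements of `l` satisfy `p`. -/
def prependBits {α : Type*} (l : List α) (p : α → Prop) (m : ℕ) : ℕ :=
  l.foldr (fun c m => Nat.bit (decide (p c)) m) m

theorem prependBits_land {α : Type*} (l : List α) (p q : α → Prop) (m n : ℕ) :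
    prependBits l p m &&& prependBits l q n = prependBits l (fun c => p c ∧ q c) (m &&& n) := by
  induction l with
  | nil => rfl
  | cons c l ih =>
    simp only [prependBits, List.foldr_cons, Nat.land_bit] at ih ⊢
    rw [ih]
    congr 1
    rw [Bool.eq_iff_iff]
    simp

theorem prependBits_eq_iff {α : Type*} {l : List α} {p q : α → Prop} {m n : ℕ} :
    prependBits l p m = prependBits l q n ↔ (∀ c ∈ l, (p c ↔ q c)) ∧ m = n := by
  induction l with
  | nil => simp [prependBits]
  | cons c l ih =>
    simp only [prependBits, List.foldr_cons, bit_eq_bit_iff, decide_eq_decide] at ih ⊢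
    rw [ih, List.forall_mem_cons, and_assoc]

theorem prependBits_div {α : Type*} (l : List α) (p : α → Prop) (m : ℕ) :
    prependBits l p m / 2 ^ l.length = m := by
  induction l with
  | nil => simp [prependBits]
  | cons c l ih =>
    rw [List.length_cons, pow_succ', ← Nat.div_div_eq_div_mul]
    simpa [prependBits] using ih

theorem prependBits_of_forall_not {α : Type*} {l : List α} {p : α → Prop} (h : ∀ c ∈ l, ¬ p c)
    (m : ℕ) : prependBits l p m = 2 ^ l.length * m := by
  induction l with
  | nil => simp [prependBits]
  | cons c l ih =>
    rw [List.forall_mem_cons] at h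
    have := ih h.2
    simp only [prependBits, List.foldr_cons, h.1, decide_false, Nat.bit_false] at this ⊢
    rw [this, List.length_cons, pow_succ', mul_assoc]

theorem prependBits_true {α : Type*} (l : List α) :
    prependBits l (fun _ => True) 0 + 1 = 2 ^ l.length := by
  induction l with
  | nil => simp [prependBits]
  | cons c l ih =>
    simp only [prependBits, List.foldr_cons, decide_true, Nat.bit_true] at ih ⊢
    rw [List.length_cons, pow_succ', ← ih]
    ring

/-- The number whose binary digits tell which orderings of the triples in `L` satisfy `p`. -/
def maskOf (L : List (Fin 6 × Fin 6 × Fin 6)) (p : (Fin 3 → Fin 6) → Prop) : ℕ :=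
  prependBits (L.flatMap orderings) p 0

theorem maskOf_cons (s : Fin 6 × Fin 6 × Fin 6) (L : List (Fin 6 × Fin 6 × Fin 6))
    (p : (Fin 3 → Fin 6) → Prop) :
    maskOf (s :: L) p = prependBits (orderings s) p (maskOf L p) := by
  simp [maskOf, prependBits]

theorem maskOf_land (L : List (Fin 6 × Fin 6 × Fin 6)) (p q : (Fin 3 → Fin 6) → Prop) :
    Nat.land (maskOf L p) (maskOf L q) = maskOf L fun c => p c ∧ q c :=
  prependBits_land _ p q 0 0

theorem maskOf_inj {L : List (Fin 6 × Fin 6 × Fin 6)} {p q : (Fin 3 → Fin 6) → Prop} :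
    maskOf L p = maskOf L q ↔ ∀ s ∈ L, ∀ c ∈ orderings s, (p c ↔ q c) := by
  simp only [maskOf, prependBits_eq_iff, and_true, List.mem_flatMap]
  grind

/-- The lowest six bits belong to the head of `L`; they vanish exactly when no ordering of it
satisfies `p`, and division by 64 removes them. -/
theorem exists_of_hitsBlocks {L : List (Fin 6 × Fin 6 × Fin 6)} {p : (Fin 3 → Fin 6) → Prop}
    (h : hitsBlocks L.length (maskOf L p) = true) : ∀ s ∈ L, ∃ c ∈ orderings s, p c := by
  induction L with
  | nil => simp
  | cons s L ih =>
    have hdiv := prependBits_div (orderings s) p (maskOf L p)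
    have hlen : 2 ^ (orderings s).length = 64 := rfl
    rw [List.length_cons, hitsBlocks, maskOf_cons, ← hlen, hdiv, Bool.cond_eq_ite] at h
    split_ifs at h with hb
    refine List.forall_mem_cons.2 ⟨?_, ih h⟩
    by_contra! hno
    simp [prependBits_of_forall_not hno] at hb

theorem maskOf_true : maskOf columnTriples (fun _ => True) = fullMask := by
  have := prependBits_true (columnTriples.flatMap orderings)
  have hlen : (columnTriples.flatMap orderings).length = 120 := rfl
  rw [hlen] at this
  exact Nat.succ.inj this

/-- The mask of a real weight. -/
def realMask (w : Fin 3 → Fin 3 → ℝ) : ℕ := maskOf columnTriples (IsMaximal w)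

/-- An integral weight as a real weight. -/
def IntWeight.toReal (g : IntWeight) : Fin 3 → Fin 3 → ℝ := fun i j => g i j

theorem weightForm_toReal (g : IntWeight) (c : Fin 3 → Fin 6) :
    weightForm g.toReal (columnPoint c) =
      ((quadricWeight (g 0) (c 0) + quadricWeight (g 1) (c 1) +
        quadricWeight (g 2) (c 2) : ℕ) : ℝ) := by
  have h : ∀ i, ∑ j, (g i j : ℝ) * quadricExponent (c i) j = quadricWeight (g i) (c i) := by
    intro i
    generalize c i = k
    fin_cases k <;> simp [quadricExponent, quadricWeight, Fin.sum_univ_three, mul_comm]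
  simp only [weightForm_apply, columnPoint, IntWeight.toReal, h]
  simp [Fin.sum_univ_three]

theorem natMax_eq (a b : ℕ) : natMax a b = max a b := by
  simp only [natMax, Bool.cond_eq_ite, Nat.ble_eq, Nat.max_def]

/-- Links the computed masks to the geometry: comparing natural numbers with the largest of six
decides maximality of the real weight. -/
theorem mask_eq_realMask (g : IntWeight) : mask g = realMask g.toReal := by
  rw [realMask]
  unfold mask
  induction columnTriples with
  | nil => rfl
  | cons s L ih =>
    obtain ⟨i, j, k⟩ := s
    rw [maskOf_cons, ← ih, List.foldr_cons]
    generalize List.foldr _ 0 L = m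
    have key : ∀ c ∈ orderings (i, j, k), ∀ v t : ℕ, weightForm g.toReal (columnPoint c) = v →
        (v = t ↔ ∀ c' ∈ orderings (i, j, k),
          weightForm g.toReal (columnPoint c') ≤ v) →
        Nat.beq v t = @decide (IsMaximal g.toReal c) (Classical.propDecidable _) := by
      intro c hc v t hv ht
      rw [Bool.eq_iff_iff]
      simp only [Nat.beq_eq, decide_eq_true_eq, isMaximal_iff hc, ht, hv]
    simp only [prependMaxBits, prependBits, natMax_eq]
    simp only [orderings, List.foldr_cons, List.foldr_nil, bit_eq_bit_iff, and_true]
    refine ⟨?_, ?_, ?_, ?_, ?_, ?_⟩ <;>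
    · refine key _ (by simp [orderings]) _ _ (weightForm_toReal _ _) ?_
      simp only [orderings, List.forall_mem_cons, List.not_mem_nil, IsEmpty.forall_iff,
        implies_true, and_true, weightForm_toReal, Nat.cast_le]
      simp only [Matrix.cons_val]
      omega

/-! ### Faces and masks -/

/-- The face of `minorPolytope` in the direction of a weight. -/
def weightFace (w : Fin 3 → Fin 3 → ℝ) : Set (Fin 3 × Fin 3 → ℝ) :=
  maximalFace minorPolytope (weightForm w)

theorem weightFace_nonempty (w : Fin 3 → Fin 3 → ℝ) : (weightFace w).Nonempty :=
  maximalFace_hullSum_nonempty _ _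

theorem isMaximizer_minorColumns_iff {w : Fin 3 → Fin 3 → ℝ}
    {S : {S : Finset (Fin 6) // S.card = 3}} {σ : Equiv.Perm (Fin 3)} :
    IsMaximizer (fun S σ => columnPoint (minorColumns S σ)) (weightForm w) S σ ↔
      IsMaximal w (minorColumns S σ) := by
  constructor
  · exact fun h π => h (σ * π)
  · intro h τ
    have := h (σ⁻¹ * τ)
    rwa [minorColumns, Function.comp_assoc, ← Equiv.Perm.coe_mul, mul_inv_cancel_left] at this

theorem exists_mem_orderings : ∀ c : Fin 3 → Fin 6, Function.Injective c →
    ∃ s ∈ columnTriples, c ∈ orderings s := by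
  decide +kernel

theorem injective_of_mem_orderings :
    ∀ s ∈ columnTriples, ∀ c ∈ orderings s, Function.Injective c := by
  decide +kernel

theorem exists_eq_minorColumns {c : Fin 3 → Fin 6} (hc : Function.Injective c) :
    ∃ S σ, c = minorColumns S σ := by
  let S : {S : Finset (Fin 6) // S.card = 3} :=
    ⟨Finset.univ.image c, by simp [Finset.card_image_of_injective _ hc]⟩
  have h : ∀ i, ∃ k, S.1.orderEmbOfFin S.2 k = c i := fun i => by
    have : c i ∈ Set.range (S.1.orderEmbOfFin S.2) := by
      rw [Finset.range_orderEmbOfFin]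
      simp [S]
    exact this
  choose f hf using h
  have hinj : Function.Injective f := fun i j hij => hc (by rw [← hf, ← hf, hij])
  exact ⟨S, Equiv.ofBijective f (Finite.injective_iff_bijective.1 hinj),
    funext fun i => (hf i).symm⟩

theorem forall_minorColumns_iff {p : (Fin 3 → Fin 6) → Prop} :
    (∀ S σ, p (minorColumns S σ)) ↔ ∀ s ∈ columnTriples, ∀ c ∈ orderings s, p c := by
  constructor
  · intro h s hs c hc
    obtain ⟨S, σ, rfl⟩ := exists_eq_minorColumns (injective_of_mem_orderings s hs c hc)
    exact h S σ
  · intro h S σ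
    obtain ⟨s, hs, hc⟩ := exists_mem_orderings (minorColumns S σ)
      ((S.1.orderEmbOfFin S.2).injective.comp σ.injective)
    exact h s hs _ hc

/-- Inclusion of faces of a Minkowski sum is inclusion of the sets of maximizers in each summand,
which is inclusion of bits. -/
theorem weightFace_subset_iff {w w' : Fin 3 → Fin 3 → ℝ} :
    weightFace w ⊆ weightFace w' ↔ Nat.land (realMask w) (realMask w') = realMask w := by
  rw [realMask, realMask, maskOf_land, maskOf_inj, ← forall_minorColumns_iff
    (p := fun c => (IsMaximal w c ∧ IsMaximal w' c ↔ IsMaximal w c))]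
  simp only [and_iff_left_iff_imp, ← isMaximizer_minorColumns_iff]
  exact ⟨fun h S σ => isMaximizer_of_maximalFace_subset h, maximalFace_subset_of_isMaximizer⟩

theorem weightFace_eq_iff {w w' : Fin 3 → Fin 3 → ℝ} :
    weightFace w = weightFace w' ↔ realMask w = realMask w' := by
  constructor
  · intro h
    have h1 := weightFace_subset_iff.1 h.subset
    have h2 := weightFace_subset_iff.1 h.symm.subset
    exact h1.symm.trans ((Nat.and_comm _ _).trans h2)
  · intro h
    refine Set.Subset.antisymm (weightFace_subset_iff.2 ?_) (weightFace_subset_iff.2 ?_) <;>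
    · rw [h]
      exact Nat.and_self _

theorem polytopeDim_weightFace_lt {w w' : Fin 3 → Fin 3 → ℝ}
    (h : Nat.land (realMask w) (realMask w') = realMask w) (hne : realMask w ≠ realMask w') :
    polytopeDim (weightFace w) < polytopeDim (weightFace w') :=
  polytopeDim_maximalFace_lt (weightFace_nonempty w) (maximalFace_subset _ _)
    ((weightFace_subset_iff.2 h).ssubset_of_ne fun heq => hne (weightFace_eq_iff.1 heq))

/-! ### Cones of weights -/

/-- The weights in a cone, up to the lineality space. -/
def Cone.Contains : Cone → (Fin 3 → Fin 3 → ℝ) → Prop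
  | .mk x y z t, w => ∃ a b c d : ℝ, 0 ≤ a ∧ 0 ≤ b ∧ 0 ≤ c ∧ 0 ≤ d ∧ ∃ u v : Fin 3 → ℝ,
      ∀ i j, w i j = a * x i j + b * y i j + c * z i j + d * t i j + (u i + v j)

theorem Cone.contains_moveToFront {C : Cone} {w : Fin 3 → Fin 3 → ℝ} (h : C.Contains w) (p : ℕ) :
    (C.moveToFront p).Contains w := by
  obtain ⟨x, y, z, t⟩ := C
  obtain ⟨a, b, c, d, ha, hb, hc, hd, u, v, h⟩ := h
  match p with
  | 0 => exact ⟨a, b, c, d, ha, hb, hc, hd, u, v, h⟩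
  | 1 => exact ⟨a, c, b, d, ha, hc, hb, hd, u, v, fun i j => by rw [h]; ring⟩
  | 2 => exact ⟨a, d, b, c, ha, hd, hb, hc, u, v, fun i j => by rw [h]; ring⟩
  | 3 => exact ⟨b, c, a, d, hb, hc, ha, hd, u, v, fun i j => by rw [h]; ring⟩
  | 4 => exact ⟨b, d, a, c, hb, hd, ha, hc, u, v, fun i j => by rw [h]; ring⟩
  | _ + 5 => exact ⟨c, d, a, b, hc, hd, ha, hb, u, v, fun i j => by rw [h]; ring⟩

theorem exists_combination_eq (n : ℕ) (x y : IntWeight) : ∃ p q : ℝ, 0 < p ∧ 0 < q ∧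
    ∀ i j, (combination n x y i j : ℝ) = p * x i j + q * y i j := by
  match n with
  | 0 => exact ⟨1, 1, one_pos, one_pos, fun i j => by simp [combination]⟩
  | 1 => exact ⟨2, 1, two_pos, one_pos, fun i j => by simp [combination]⟩
  | _ + 2 => exact ⟨1, 2, one_pos, two_pos, fun i j => by simp [combination]⟩

/-- With the new generator `p x + q y`, compare `a / p` and `b / q`: the smaller one is its
coefficient, and what remains is a nonnegative multiple of the other old generator. -/
theorem Cone.contains_split {x y z t : IntWeight} {w : Fin 3 → Fin 3 → ℝ}
    (h : (Cone.mk x y z t).Contains w) (n : ℕ) :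
    (Cone.mk (combination n x y) y z t).Contains w ∨
      (Cone.mk x (combination n x y) z t).Contains w := by
  obtain ⟨a, b, c, d, ha, hb, hc, hd, u, v, h⟩ := h
  obtain ⟨p, q, hp, hq, hpq⟩ := exists_combination_eq n x y
  rcases le_total (a * q) (b * p) with hle | hle
  · refine Or.inl ⟨a / p, b - a / p * q, c, d, by positivity, ?_, hc, hd, u, v, fun i j => ?_⟩
    · rw [sub_nonneg, div_mul_eq_mul_div, div_le_iff₀ hp]
      exact hle
    · rw [h, hpq]
      field_simp
      ring
  · refine Or.inr ⟨a - b / q * p, b / q, c, d, ?_, by positivity, hc, hd, u, v, fun i j => ?_⟩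
    · rw [sub_nonneg, div_mul_eq_mul_div, div_le_iff₀ hq]
      exact hle
    · rw [h, hpq]
      field_simp
      ring

theorem Subdivision.subset_cones (s : Subdivision) (C : Cone) (acc : List Cone) :
    acc ⊆ s.cones C acc := by
  induction s generalizing C acc with
  | leaf => exact List.subset_cons_self _ _
  | node d l r hl hr =>
    rw [Subdivision.cones]
    split
    exact List.Subset.trans (hr _ _) (hl _ _)

theorem Subdivision.exists_mem_cones (s : Subdivision) {C : Cone} (acc : List Cone)
    {w : Fin 3 → Fin 3 → ℝ} (h : C.Contains w) : ∃ D ∈ s.cones C acc, D.Contains w := by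
  induction s generalizing C acc with
  | leaf => exact ⟨C, List.mem_cons_self, h⟩
  | node d l r hl hr =>
    have h' := C.contains_moveToFront h (d / 3)
    rw [Subdivision.cones]
    generalize C.moveToFront (d / 3) = C' at h'
    obtain ⟨x, y, z, t⟩ := C'
    rcases Cone.contains_split h' (d % 3) with h | h
    · exact hl _ h
    · obtain ⟨D, hD, hDw⟩ := hr acc h
      exact ⟨D, subset_cones _ _ _ hD, hDw⟩

theorem exists_orthant (w : Fin 3 → Fin 3 → ℝ) : ∃ C ∈ orthants, C.Contains w := by
  have key : ∀ i j : Fin 3, ∀ e : ℝ, ∃ x ∈ [coordinateWeight i j, oppositeWeight i j],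
      ∃ a : ℝ, 0 ≤ a ∧ ∃ v : Fin 3 → ℝ, ∀ k m,
        e * coordinateWeight i j k m = a * x k m + v m := by
    intro i j e
    rcases le_total 0 e with he | he
    · exact ⟨coordinateWeight i j, by simp, e, he, 0, fun k m => by simp⟩
    -- The two weights add up to the indicator of column `j`, which lies in the lineality space and
    -- absorbs the sign.
    · refine ⟨oppositeWeight i j, by simp, -e, neg_nonneg.2 he, fun m => if m = j then e else 0,
        fun k m => ?_⟩
      by_cases hk : k = i <;> by_cases hm : m = j <;>
        simp [coordinateWeight, oppositeWeight, hk, hm]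
  -- Normalization modulo the lineality space: `f` vanishes in row 0 and column 0, leaving four
  -- coordinates.
  let f : Fin 3 → Fin 3 → ℝ := fun i j => w i j - w i 0 - w 0 j + w 0 0
  obtain ⟨x, hx, a, ha, v₁, h₁⟩ := key 1 1 (f 1 1)
  obtain ⟨y, hy, b, hb, v₂, h₂⟩ := key 1 2 (f 1 2)
  obtain ⟨z, hz, c, hc, v₃, h₃⟩ := key 2 1 (f 2 1)
  obtain ⟨t, ht, d, hd, v₄, h₄⟩ := key 2 2 (f 2 2)
  refine ⟨.mk x y z t, ?_, a, b, c, d, ha, hb, hc, hd, fun i => w i 0 - w 0 0,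
    fun j => w 0 j + v₁ j + v₂ j + v₃ j + v₄ j, fun i j => ?_⟩
  · simp only [orthants, List.mem_flatMap, List.mem_map]
    exact ⟨x, hx, y, hy, z, hz, t, ht, rfl⟩
  · have hf : f i j = f 1 1 * coordinateWeight 1 1 i j + f 1 2 * coordinateWeight 1 2 i j +
        f 2 1 * coordinateWeight 2 1 i j + f 2 2 * coordinateWeight 2 2 i j := by
      fin_cases i <;> fin_cases j <;> simp [f, coordinateWeight]
    rw [h₁, h₂, h₃, h₄] at hf
    simp only [f] at hf
    linarith

theorem exists_fanCone (w : Fin 3 → Fin 3 → ℝ) : ∃ C ∈ fanCones, C.Contains w := by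
  obtain ⟨C, hC, hCw⟩ := exists_orthant w
  -- `zip` truncates, so no orthant may lack a code.
  have hlen : orthants.length ≤ subdivisionCodes.length := by decide +kernel
  rw [← List.map_fst_zip hlen] at hC
  unfold fanCones
  clear hlen
  revert hC
  induction orthants.zip subdivisionCodes with
  | nil => simp
  | cons p L ih =>
    intro hC
    rw [List.map_cons, List.mem_cons] at hC
    rw [List.foldr_cons]
    rcases hC with rfl | hC
    · exact Subdivision.exists_mem_cones _ _ hCw
    · obtain ⟨D, hD, hDw⟩ := ih hC
      exact ⟨D, Subdivision.subset_cones _ _ _ hD, hDw⟩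

/-! ### Masks of the weights in a cone -/

/-- In each minor, some monomial has maximal weight for each of the four weights. -/
def HaveCommonMaxima (x y z t : IntWeight) : Prop :=
  ∀ s ∈ columnTriples, ∃ c ∈ orderings s,
    IsMaximal x.toReal c ∧ IsMaximal y.toReal c ∧ IsMaximal z.toReal c ∧ IsMaximal t.toReal c

theorem haveCommonMaxima_of_hitsBlocks {x y z t : IntWeight}
    (h : hitsBlocks 20 (totalMask (Cone.mk x y z t).masks) = true) : HaveCommonMaxima x y z t := by
  simp only [totalMask, Cone.masks, mask_eq_realMask, realMask, maskOf_land] at h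
  intro s hs
  obtain ⟨c, hc, h⟩ := exists_of_hitsBlocks (L := columnTriples) h s hs
  exact ⟨c, hc, h.1.1, h.1.2, h.2.1, h.2.2⟩

/-- At the common maximizer `e₀` all four terms attain their maxima. Hence `e` is maximal for the
combination exactly when it loses nothing in any term with nonzero coefficient. -/
theorem isMaximal_combination_iff {x y z t : IntWeight} {w : Fin 3 → Fin 3 → ℝ} {a b c d : ℝ}
    (ha : 0 ≤ a) (hb : 0 ≤ b) (hc : 0 ≤ c) (hd : 0 ≤ d) {u v : Fin 3 → ℝ}
    (hw : ∀ i j, w i j = a * x i j + b * y i j + c * z i j + d * t i j + (u i + v j))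
    {s : Fin 6 × Fin 6 × Fin 6} {e₀ e : Fin 3 → Fin 6} (he₀ : e₀ ∈ orderings s)
    (he : e ∈ orderings s) (hx : IsMaximal x.toReal e₀) (hy : IsMaximal y.toReal e₀)
    (hz : IsMaximal z.toReal e₀) (ht : IsMaximal t.toReal e₀) :
    IsMaximal w e ↔ ((a = 0 ∨ IsMaximal x.toReal e) ∧ (b = 0 ∨ IsMaximal y.toReal e)) ∧
      ((c = 0 ∨ IsMaximal z.toReal e) ∧ (d = 0 ∨ IsMaximal t.toReal e)) := by
  have hlin : ∀ e' ∈ orderings s, weightForm (fun i j => u i + v j) (columnPoint e') =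
      weightForm (fun i j => u i + v j) (columnPoint e) := by
    obtain ⟨π, rfl⟩ := mem_orderings_iff.1 he
    intro e' he'
    obtain ⟨π', rfl⟩ := mem_orderings_iff.1 he'
    rw [weightForm_lineality, weightForm_lineality]
  have hform : ∀ p, weightForm w p = a * weightForm x.toReal p + b * weightForm y.toReal p +
      c * weightForm z.toReal p + d * weightForm t.toReal p +
      weightForm (fun i j => u i + v j) p := by
    intro p
    simp only [weightForm_apply, hw, add_mul, Finset.sum_add_distrib, Finset.mul_sum, mul_assoc,
      IntWeight.toReal]
  rw [isMaximal_iff he₀] at hx hy hz ht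
  simp only [isMaximal_iff he, hform]
  constructor
  · intro h
    have h0 := h e₀ he₀
    rw [hlin e₀ he₀] at h0
    have hx' := mul_nonneg ha (sub_nonneg.2 (hx e he))
    have hy' := mul_nonneg hb (sub_nonneg.2 (hy e he))
    have hz' := mul_nonneg hc (sub_nonneg.2 (hz e he))
    have ht' := mul_nonneg hd (sub_nonneg.2 (ht e he))
    have key : ∀ {r : ℝ} {g : IntWeight},
        (∀ c' ∈ orderings s, weightForm g.toReal (columnPoint c') ≤
          weightForm g.toReal (columnPoint e₀)) →
        r * (weightForm g.toReal (columnPoint e₀) - weightForm g.toReal (columnPoint e)) ≤ 0 →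
        0 ≤ r * (weightForm g.toReal (columnPoint e₀) - weightForm g.toReal (columnPoint e)) →
        r = 0 ∨ ∀ c' ∈ orderings s, weightForm g.toReal (columnPoint c') ≤
          weightForm g.toReal (columnPoint e) := by
      intro r g hg h1 h2
      refine (mul_eq_zero.1 (le_antisymm h1 h2)).imp_right fun h c' hc' => ?_
      exact sub_eq_zero.1 h ▸ hg c' hc'
    exact ⟨⟨key hx (by linarith) hx', key hy (by linarith) hy'⟩,
      key hz (by linarith) hz', key ht (by linarith) ht'⟩
  · rintro ⟨⟨h1, h2⟩, h3, h4⟩ e' he'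
    rw [hlin e' he']
    have key : ∀ {r : ℝ} {g : IntWeight}, 0 ≤ r → (r = 0 ∨ ∀ c' ∈ orderings s,
        weightForm g.toReal (columnPoint c') ≤ weightForm g.toReal (columnPoint e)) →
        r * weightForm g.toReal (columnPoint e') ≤ r * weightForm g.toReal (columnPoint e) := by
      rintro r g hr (rfl | h)
      · simp
      · exact mul_le_mul_of_nonneg_left (h e' he') hr
    linarith [key ha h1, key hb h2, key hc h3, key hd h4]

open Classical in
/-- The mask of a generator that occurs with coefficient `a`. -/
def coefficientMask (a : ℝ) (x : IntWeight) : ℕ := if a = 0 then fullMask else mask x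

theorem coefficientMask_eq (a : ℝ) (x : IntWeight) :
    coefficientMask a x = maskOf columnTriples fun c => a = 0 ∨ IsMaximal x.toReal c := by
  unfold coefficientMask
  split_ifs with h
  · simp [h, ← maskOf_true]
  · simp [h, mask_eq_realMask, realMask]

theorem realMask_combination {x y z t : IntWeight} (h : HaveCommonMaxima x y z t)
    {w : Fin 3 → Fin 3 → ℝ} {a b c d : ℝ} (ha : 0 ≤ a) (hb : 0 ≤ b) (hc : 0 ≤ c) (hd : 0 ≤ d)
    {u v : Fin 3 → ℝ}
    (hw : ∀ i j, w i j = a * x i j + b * y i j + c * z i j + d * t i j + (u i + v j)) :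
    realMask w = Nat.land (Nat.land (coefficientMask a x) (coefficientMask b y))
      (Nat.land (coefficientMask c z) (coefficientMask d t)) := by
  simp only [coefficientMask_eq, maskOf_land, realMask, maskOf_inj]
  intro s hs e he
  obtain ⟨e₀, he₀, hx, hy, hz, ht⟩ := h s hs
  exact isMaximal_combination_iff ha hb hc hd hw he₀ he hx hy hz ht

theorem land_fullMask (p : (Fin 3 → Fin 6) → Prop) :
    Nat.land (maskOf columnTriples p) fullMask = maskOf columnTriples p := by
  simp only [← maskOf_true, maskOf_land, and_true]

theorem fullMask_land (p : (Fin 3 → Fin 6) → Prop) :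
    Nat.land fullMask (maskOf columnTriples p) = maskOf columnTriples p := by
  simp only [← maskOf_true, maskOf_land, true_and]

theorem realMask_eq_fullMask_or_mem {x y z t : IntWeight} (h : HaveCommonMaxima x y z t)
    {w : Fin 3 → Fin 3 → ℝ} (hw : (Cone.mk x y z t).Contains w) :
    realMask w = fullMask ∨ realMask w ∈ generatorMasks (Cone.mk x y z t).masks ∨
      realMask w ∈ pairMasks (Cone.mk x y z t).masks ∨
      realMask w ∈ tripleMasks (Cone.mk x y z t).masks ∨
      realMask w = totalMask (Cone.mk x y z t).masks := by
  obtain ⟨a, b, c, d, ha, hb, hc, hd, u, v, hw⟩ := hw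
  rw [realMask_combination h ha hb hc hd hw]
  have hf : Nat.land fullMask fullMask = fullMask := Nat.and_self _
  -- The sixteen cases are the faces of the simplicial cone; a vanishing coefficient contributes
  -- `fullMask`, neutral for AND.
  by_cases ha : a = 0 <;> by_cases hb : b = 0 <;> by_cases hc : c = 0 <;> by_cases hd : d = 0 <;>
    simp only [coefficientMask, ha, hb, hc, hd, if_true, if_false, generatorMasks,
      pairMasks, tripleMasks, totalMask, Cone.masks, mask_eq_realMask, realMask,
      maskOf_land, hf, land_fullMask, fullMask_land, List.mem_cons,
      true_or, or_true]

/-! ### Flags of faces -/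

/-- The masks `e` of a strict flag of faces, from the vertex to the facet. -/
def IsStrictFlag (e : ℕ × ℕ × ℕ × ℕ) : Prop :=
  ∃ x y z t : IntWeight, HaveCommonMaxima x y z t ∧
    (∃ acc, e ∈ strictFlag (mask x) (mask y) (mask z) (mask t) acc ∧ e ∉ acc)

theorem isStrictFlag_of_mem {L : List Cone}
    (hL : ∀ x y z t, Cone.mk x y z t ∈ L → HaveCommonMaxima x y z t) :
    ∀ e ∈ strictFlags (L.map Cone.masks), IsStrictFlag e := by
  induction L with
  | nil => simp [strictFlags]
  | cons C L ih =>
    obtain ⟨x, y, z, t⟩ := C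
    have h : HaveCommonMaxima x y z t := hL x y z t List.mem_cons_self
    intro e he
    simp only [strictFlags, List.map_cons, List.foldr_cons] at he
    -- The four nested calls are peeled from the inside out: the first list containing `e` shows
    -- which ordering of the generators produced it.
    refine (Classical.em _).elim (ih (fun x y z t hC => hL x y z t (List.mem_cons_of_mem _ hC)) e)
      fun h₄ => ?_
    simp only [strictFlags] at h₄
    refine (Classical.em _).elim (fun h₃ => ⟨t, x, z, y, ?_, _, h₃, h₄⟩) fun h₃ => ?_
    · exact fun s hs => (h s hs).imp fun c hc => ⟨hc.1, by tauto⟩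
    refine (Classical.em _).elim (fun h₂ => ⟨z, t, y, x, ?_, _, h₂, h₃⟩) fun h₂ => ?_
    · exact fun s hs => (h s hs).imp fun c hc => ⟨hc.1, by tauto⟩
    refine (Classical.em _).elim (fun h₁ => ⟨z, x, y, t, ?_, _, h₁, h₂⟩)
      fun h₁ => ⟨y, x, t, z, ?_, _, he, h₁⟩
    all_goals exact fun s hs => (h s hs).imp fun c hc => ⟨hc.1, by tauto⟩

theorem mem_strictFlag {a b c d : ℕ} {acc : List (ℕ × ℕ × ℕ × ℕ)} {e : ℕ × ℕ × ℕ × ℕ}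
    (h : e ∈ strictFlag a b c d acc) (hacc : e ∉ acc) :
    a ≠ fullMask ∧ a &&& b ≠ a ∧ a &&& b &&& c ≠ a &&& b ∧
      a &&& b &&& c &&& d ≠ a &&& b &&& c ∧
      e = (a &&& b &&& c &&& d, a &&& b &&& c, a &&& b, a) := by
  simp only [strictFlag, Bool.cond_eq_ite, Nat.beq_eq] at h
  split_ifs at h with h₁ h₂ h₃ h₄
  iterate 4 exact absurd h hacc
  exact ⟨h₁, h₂, h₃, h₄, (List.mem_cons.1 h).resolve_right hacc⟩

theorem weightFace_zero : weightFace 0 = minorPolytope := by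
  refine Set.Subset.antisymm (maximalFace_subset _ _) fun x hx => ⟨hx, fun y _ => ?_⟩
  simp [weightForm_apply]

theorem realMask_zero : realMask 0 = fullMask := by
  rw [← maskOf_true]
  refine maskOf_inj.2 fun s _ c _ => iff_true_intro fun π => ?_
  simp [weightForm_apply]

/-- The partial sums of the four generators have the masks of the flag. Five strictly increasing
dimensions, the last at most 4, can only be 0, 1, 2, 3, 4. -/
theorem polytopeDim_of_isStrictFlag {e : ℕ × ℕ × ℕ × ℕ} (he : IsStrictFlag e) :
    (∃ w, realMask w = e.1 ∧ polytopeDim (weightFace w) = 0) ∧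
    (∃ w, realMask w = e.2.1 ∧ polytopeDim (weightFace w) = 1) ∧
    (∃ w, realMask w = e.2.2.1 ∧ polytopeDim (weightFace w) = 2) ∧
    (∃ w, realMask w = e.2.2.2 ∧ polytopeDim (weightFace w) = 3) ∧
    polytopeDim minorPolytope = 4 := by
  obtain ⟨x, y, z, t, h, acc, he, hacc⟩ := he
  obtain ⟨h₁, h₂, h₃, h₄, rfl⟩ := mem_strictFlag he hacc
  have hmask : ∀ a b c d : ℝ, 0 ≤ a → 0 ≤ b → 0 ≤ c → 0 ≤ d →
      realMask (fun i j => a * x i j + b * y i j + c * z i j + d * t i j) =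
        (coefficientMask a x &&& coefficientMask b y) &&&
          (coefficientMask c z &&& coefficientMask d t) := fun a b c d ha hb hc hd =>
    realMask_combination (u := 0) (v := 0) h ha hb hc hd fun i j => by simp
  have hfull : ∀ g : IntWeight, mask g &&& fullMask = mask g := fun g => by
    rw [mask_eq_realMask]
    exact land_fullMask _
  have hfull₂ : ∀ g g' : IntWeight, mask g &&& mask g' &&& fullMask = mask g &&& mask g' :=
    fun g g' => by rw [Nat.and_assoc, hfull]
  have m₁ := hmask 1 0 0 0 (by simp) (by simp) (by simp) (by simp)
  have m₂ := hmask 1 1 0 0 (by simp) (by simp) (by simp) (by simp)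
  have m₃ := hmask 1 1 1 0 (by simp) (by simp) (by simp) (by simp)
  have m₄ := hmask 1 1 1 1 (by simp) (by simp) (by simp) (by simp)
  simp only [coefficientMask, one_ne_zero, if_true, if_false, hfull, hfull₂,
    ← Nat.and_assoc] at m₁ m₂ m₃ m₄
  set w₁ : Fin 3 → Fin 3 → ℝ := fun i j => 1 * x i j + 0 * y i j + 0 * z i j + 0 * t i j
  set w₂ : Fin 3 → Fin 3 → ℝ := fun i j => 1 * x i j + 1 * y i j + 0 * z i j + 0 * t i j
  set w₃ : Fin 3 → Fin 3 → ℝ := fun i j => 1 * x i j + 1 * y i j + 1 * z i j + 0 * t i j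
  set w₄ : Fin 3 → Fin 3 → ℝ := fun i j => 1 * x i j + 1 * y i j + 1 * z i j + 1 * t i j
  have hlt : ∀ {w w' : Fin 3 → Fin 3 → ℝ} {n : ℕ}, realMask w = realMask w' &&& n →
      realMask w ≠ realMask w' → polytopeDim (weightFace w) < polytopeDim (weightFace w') := by
    intro w w' n hw hne
    refine polytopeDim_weightFace_lt ?_ hne
    change realMask w &&& realMask w' = realMask w
    rw [hw, Nat.and_right_comm, Nat.and_self]
  have l₄ := hlt (w := w₄) (w' := w₃) (n := mask t) (by rw [m₃, m₄]) (by rwa [m₃, m₄])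
  have l₃ := hlt (w := w₃) (w' := w₂) (n := mask z) (by rw [m₂, m₃]) (by rwa [m₂, m₃])
  have l₂ := hlt (w := w₂) (w' := w₁) (n := mask y) (by rw [m₁, m₂]) (by rwa [m₁, m₂])
  have l₁ := hlt (w := w₁) (w' := 0) (n := mask x)
    (by rw [m₁, realMask_zero, Nat.and_comm, hfull]) (by rwa [m₁, realMask_zero])
  rw [weightFace_zero] at l₁
  have l₀ := polytopeDim_minorPolytope_le
  exact ⟨⟨w₄, m₄, by omega⟩, ⟨w₃, m₃, by omega⟩, ⟨w₂, m₂, by omega⟩, ⟨w₁, m₁, by omega⟩, by omega⟩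

/-! ### Counting faces -/

/-- Faces and masks determine each other, so the faces of dimension `k` are counted by a list
without repetitions of their masks. -/
theorem encard_polytopeFaces {N : List ℕ} (hN : N.Nodup) {k : ℕ}
    (h : ∀ m ∈ N, ∃ w, realMask w = m ∧ polytopeDim (weightFace w) = k)
    (h' : ∀ w, polytopeDim (weightFace w) = k → realMask w ∈ N) :
    (polytopeFaces minorPolytope k).encard = N.length := by
  choose! w hw using h
  have himage : polytopeFaces minorPolytope k =
      (fun m => weightFace (w m)) '' (N.toFinset : Set ℕ) := by
    ext F
    simp only [mem_polytopeFaces_iff, Set.mem_image, Finset.mem_coe, List.mem_toFinset]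
    constructor
    · rintro ⟨l, rfl, -, hdim⟩
      obtain ⟨v, rfl⟩ := exists_eq_weightForm l
      have hv := h' v hdim
      exact ⟨_, hv, weightFace_eq_iff.2 (hw _ hv).1⟩
    · rintro ⟨m, hm, rfl⟩
      exact ⟨_, rfl, weightFace_nonempty _, (hw m hm).2⟩
  rw [himage, Set.InjOn.encard_image, Set.encard_coe_eq_coe_finsetCard,
    List.toFinset_card_of_nodup hN]
  intro m hm n hn hmn
  simp only [Finset.mem_coe, List.mem_toFinset] at hm hn
  have := weightFace_eq_iff.1 hmn
  rwa [(hw m hm).1, (hw n hn).1] at this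

/-! ### Correctness of the search trees -/

namespace SearchTree

theorem insert_node {α : Type} (n k : ℕ) (l r : SearchTree) (f : SearchTree → α) :
    (node l k r).insert n f = cond (Nat.beq n k) (f (node l k r))
      (cond (Nat.ble n k) (l.insert n fun l' => f (node l' k r))
        (r.insert n fun r' => f (node l k r'))) := rfl

theorem find_node (n k : ℕ) (l r : SearchTree) :
    (node l k r).find n = cond (Nat.beq n k) true (cond (Nat.ble n k) (l.find n) (r.find n)) := rfl

theorem insert_eq {α : Type} (n : ℕ) (T : SearchTree) (f : SearchTree → α) :
    T.insert n f = f (T.insert n id) := by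
  induction T generalizing α with
  | nil => rfl
  | node l k r hl hr =>
    simp only [insert_node]
    cases Nat.beq n k
    · cases Nat.ble n k
      · exact (hr _).trans (congrArg f (hr fun r' => node l k r').symm)
      · exact (hl _).trans (congrArg f (hl fun l' => node l' k r).symm)
    · rfl

theorem insertAll_eq {α : Type} (L : List ℕ) (T : SearchTree) (f : SearchTree → α) :
    insertAll L T f = f (insertAll L T id) := by
  induction L generalizing T with
  | nil => rfl
  | cons n L ih =>
    rw [insertAll, insertAll, insert_eq, ih, insert_eq n T fun T' => insertAll L T' id]

/-- The search tree of the numbers in a list. -/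
def ofList (L : List ℕ) : SearchTree := insertAll L nil id

theorem insertAll_nil {α : Type} (L : List ℕ) (f : SearchTree → α) :
    insertAll L nil f = f (ofList L) := insertAll_eq L nil f

/-- The numbers at the nodes of a tree. -/
def Mem (m : ℕ) : SearchTree → Prop
  | nil => False
  | node l k r => Mem m l ∨ m = k ∨ Mem m r

theorem mem_toList {m : ℕ} {T : SearchTree} {acc : List ℕ} :
    m ∈ T.toList acc ↔ T.Mem m ∨ m ∈ acc := by
  induction T generalizing acc with
  | nil => simp [toList, Mem]
  | node l k r hl hr =>
    rw [toList, hl, List.mem_cons, hr, Mem]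
    tauto

theorem mem_of_find {m : ℕ} {T : SearchTree} (h : T.find m = true) : T.Mem m := by
  induction T with
  | nil => simp [find] at h
  | node l k r hl hr =>
    rw [find_node] at h
    rw [Mem]
    cases hb : Nat.beq m k
    · rw [hb, cond_false] at h
      cases hb' : Nat.ble m k
      · rw [hb', cond_false] at h
        exact Or.inr (Or.inr (hr h))
      · rw [hb', cond_true] at h
        exact Or.inl (hl h)
    · exact Or.inr (Or.inl (Nat.eq_of_beq_eq_true hb))

/-- This direction suffices: stored masks must come from flags. The ordering of the tree is never
used, as `isIncreasing` separately checks that its entries are distinct. -/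
theorem mem_insert {m n : ℕ} {T : SearchTree} (h : (T.insert n id).Mem m) : m = n ∨ T.Mem m := by
  induction T with
  | nil =>
    change (node nil n nil).Mem m at h
    simpa [Mem] using h
  | node l k r hl hr =>
    rw [insert_node] at h
    cases hb : Nat.beq n k
    · cases hb' : Nat.ble n k
      · rw [hb, hb', cond_false, cond_false, insert_eq] at h
        simp only [id, Mem] at h ⊢
        rcases h with h | h | h
        · tauto
        · tauto
        · have := hr h
          tauto
      · rw [hb, hb', cond_false, cond_true, insert_eq] at h
        simp only [id, Mem] at h ⊢
        rcases h with h | h | h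
        · have := hl h
          tauto
        · tauto
        · tauto
    · rw [hb, cond_true] at h
      exact Or.inr h

theorem mem_insertAll {m : ℕ} {L : List ℕ} {T : SearchTree} (h : (insertAll L T id).Mem m) :
    m ∈ L ∨ T.Mem m := by
  induction L generalizing T with
  | nil => exact Or.inr h
  | cons n L ih =>
    rw [insertAll, insert_eq] at h
    rcases ih h with h | h
    · exact Or.inl (List.mem_cons_of_mem _ h)
    · exact (mem_insert h).imp_left fun h => List.mem_cons.2 (Or.inl h)

end SearchTree

theorem of_isIncreasing {L : List ℕ} {a n : ℕ} (h : isIncreasing L a n = true) :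
    L.length = n ∧ L.Nodup ∧ ∀ m ∈ L, a ≤ m := by
  induction L generalizing a n with
  | nil => exact ⟨(Nat.eq_of_beq_eq_true h).symm, List.nodup_nil, by simp⟩
  | cons k L ih =>
    rw [isIncreasing, Bool.cond_eq_ite] at h
    split at h
    next hn =>
      rw [Bool.cond_eq_ite] at h
      split at h
      next ha =>
        obtain ⟨h₁, h₂, h₃⟩ := ih h
        have hn := Nat.le_of_ble_eq_true hn
        have ha := Nat.le_of_ble_eq_true ha
        refine ⟨by rw [List.length_cons]; omega, List.nodup_cons.2 ⟨fun hk => ?_, h₂⟩, ?_⟩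
        · exact absurd (h₃ k hk) (by omega)
        · exact List.forall_mem_cons.2 ⟨ha, fun m hm => by have := h₃ m hm; omega⟩
      next => simp at h
    next => simp at h

theorem exists_faceMasks {L : List Cone} {F : List (ℕ × ℕ × ℕ × ℕ)}
    (hcover : ∀ w, ∃ C ∈ L, C.Contains w) (hF : F = strictFlags (L.map Cone.masks))
    (h : fanCheck (L.map Cone.masks) F = true) : ∃ N₀ N₁ N₂ N₃ : List ℕ,
      (N₀.Nodup ∧ N₀.length = 504) ∧ (N₁.Nodup ∧ N₁.length = 1056) ∧
      (N₂.Nodup ∧ N₂.length = 684) ∧ (N₃.Nodup ∧ N₃.length = 132) ∧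
      (∀ w, realMask w = fullMask ∨ realMask w ∈ N₀ ∨ realMask w ∈ N₁ ∨ realMask w ∈ N₂ ∨
        realMask w ∈ N₃) ∧
      (∀ m ∈ N₀, ∃ e, IsStrictFlag e ∧ e.1 = m) ∧ (∀ m ∈ N₁, ∃ e, IsStrictFlag e ∧ e.2.1 = m) ∧
      (∀ m ∈ N₂, ∃ e, IsStrictFlag e ∧ e.2.2.1 = m) ∧
      (∀ m ∈ N₃, ∃ e, IsStrictFlag e ∧ e.2.2.2 = m) := by
  simp only [fanCheck, SearchTree.insertAll_nil, Bool.and_eq_true, List.all_eq_true,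
    Bool.or_eq_true, List.forall_mem_map] at h
  obtain ⟨⟨⟨⟨h₀, h₁⟩, h₂⟩, h₃⟩, hL⟩ := h
  have hgood : ∀ x y z t, Cone.mk x y z t ∈ L → HaveCommonMaxima x y z t :=
    fun x y z t hC => haveCommonMaxima_of_hitsBlocks (hL _ hC).1.1.1.1
  have hflag := hF ▸ isStrictFlag_of_mem hgood
  have hmem : ∀ (f : ℕ × ℕ × ℕ × ℕ → ℕ), ∀ m ∈ (SearchTree.ofList (F.map f)).toList [],
      ∃ e, IsStrictFlag e ∧ f e = m := by
    intro f m hm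
    rcases SearchTree.mem_toList.1 hm with hm | hm
    · rcases SearchTree.mem_insertAll hm with hm | hm
      · obtain ⟨e, he, rfl⟩ := List.mem_map.1 hm
        exact ⟨e, hflag e he, rfl⟩
      · exact hm.elim
    · simp at hm
  refine ⟨_, _, _, _, ⟨(of_isIncreasing h₀).2.1, (of_isIncreasing h₀).1⟩,
    ⟨(of_isIncreasing h₁).2.1, (of_isIncreasing h₁).1⟩,
    ⟨(of_isIncreasing h₂).2.1, (of_isIncreasing h₂).1⟩,
    ⟨(of_isIncreasing h₃).2.1, (of_isIncreasing h₃).1⟩, fun w => ?_, hmem _, hmem _, hmem _, hmem _⟩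
  obtain ⟨⟨x, y, z, t⟩, hC, hw⟩ := hcover w
  obtain ⟨⟨⟨⟨-, hgen⟩, hpair⟩, htriple⟩, htotal⟩ := hL _ hC
  refine (realMask_eq_fullMask_or_mem (hgood x y z t hC) hw).imp_right fun hm => ?_
  simp only [SearchTree.mem_toList, List.not_mem_nil, or_false]
  rcases hm with hm | hm | hm | hm
  · have := hgen _ hm
    grind [SearchTree.mem_of_find]
  · have := hpair _ hm
    grind [SearchTree.mem_of_find]
  · have := htriple _ hm
    grind [SearchTree.mem_of_find]
  · exact Or.inl (SearchTree.mem_of_find (hm ▸ htotal))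

theorem hasFVector_minorPolytope :
    polytopeDim minorPolytope = 4 ∧ HasFVector minorPolytope ![504, 1056, 684, 132] := by
  obtain ⟨N₀, N₁, N₂, N₃, ⟨d₀, l₀⟩, ⟨d₁, l₁⟩, ⟨d₂, l₂⟩, ⟨d₃, l₃⟩, hall, h₀, h₁, h₂, h₃⟩ :=
    exists_faceMasks exists_fanCone rfl fanCheck_fanCones
  have dim₀ : ∀ m ∈ N₀, ∃ w, realMask w = m ∧ polytopeDim (weightFace w) = 0 := fun m hm => by
    obtain ⟨e, he, rfl⟩ := h₀ m hm
    exact (polytopeDim_of_isStrictFlag he).1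
  have dim₁ : ∀ m ∈ N₁, ∃ w, realMask w = m ∧ polytopeDim (weightFace w) = 1 := fun m hm => by
    obtain ⟨e, he, rfl⟩ := h₁ m hm
    exact (polytopeDim_of_isStrictFlag he).2.1
  have dim₂ : ∀ m ∈ N₂, ∃ w, realMask w = m ∧ polytopeDim (weightFace w) = 2 := fun m hm => by
    obtain ⟨e, he, rfl⟩ := h₂ m hm
    exact (polytopeDim_of_isStrictFlag he).2.2.1
  have dim₃ : ∀ m ∈ N₃, ∃ w, realMask w = m ∧ polytopeDim (weightFace w) = 3 := fun m hm => by
    obtain ⟨e, he, rfl⟩ := h₃ m hm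
    exact (polytopeDim_of_isStrictFlag he).2.2.2.1
  have dim₄ : polytopeDim minorPolytope = 4 := by
    obtain ⟨m, hm⟩ := List.exists_mem_of_length_pos (l := N₀) (by omega)
    obtain ⟨e, he, -⟩ := h₀ m hm
    exact (polytopeDim_of_isStrictFlag he).2.2.2.2
  have hdim : ∀ {N : List ℕ} {j : ℕ}, (∀ m ∈ N, ∃ w, realMask w = m ∧
      polytopeDim (weightFace w) = j) → ∀ w, realMask w ∈ N → polytopeDim (weightFace w) = j := by
    intro N j h w hw
    obtain ⟨v, hv, hj⟩ := h _ hw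
    rw [← weightFace_eq_iff.2 hv, hj]
  -- The listed dimensions are pairwise different, so the dimension of a face tells which list holds
  -- its mask.
  have hcases : ∀ w, polytopeDim (weightFace w) = 4 ∨
      (realMask w ∈ N₀ ∧ polytopeDim (weightFace w) = 0) ∨
      (realMask w ∈ N₁ ∧ polytopeDim (weightFace w) = 1) ∨
      (realMask w ∈ N₂ ∧ polytopeDim (weightFace w) = 2) ∨
      (realMask w ∈ N₃ ∧ polytopeDim (weightFace w) = 3) := by
    intro w
    rcases hall w with h | h | h | h | h
    · rw [← realMask_zero, ← weightFace_eq_iff, weightFace_zero] at h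
      exact Or.inl (h ▸ dim₄)
    · exact Or.inr (Or.inl ⟨h, hdim dim₀ w h⟩)
    · exact Or.inr (Or.inr (Or.inl ⟨h, hdim dim₁ w h⟩))
    · exact Or.inr (Or.inr (Or.inr (Or.inl ⟨h, hdim dim₂ w h⟩)))
    · exact Or.inr (Or.inr (Or.inr (Or.inr ⟨h, hdim dim₃ w h⟩)))
  refine ⟨dim₄, dim₄, fun k => ?_⟩
  fin_cases k
  · simpa [l₀] using encard_polytopeFaces d₀ dim₀ fun w hw => by have := hcases w; grind
  · simpa [l₁] using encard_polytopeFaces d₁ dim₁ fun w hw => by have := hcases w; grind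
  · simpa [l₂] using encard_polytopeFaces d₂ dim₂ fun w hw => by have := hcases w; grind
  · simpa [l₃] using encard_polytopeFaces d₃ dim₃ fun w hw => by have := hcases w; grind

end

theorem lemma3p2 (K : Type*) [Field K] :
    polytopeDim (newtonPolytopeOfMap (threePointMap K)) = 4 ∧
      HasFVector (newtonPolytopeOfMap (threePointMap K)) ![504, 1056, 684, 132] := by
  rw [newtonPolytopeOfMap_threePointMap]
  exact hasFVector_minorPolytope
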